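/- Let $U\subset\mathbb R^2$ be open and let $P,Q,R,S$ be smooth real functions on $U$, the coefficients of the equation $y''=P+3Qy'+3R(y')^2+S(y')^3$. Write $x^1=x$, $x^2=y$, $f_{p.q}=\partial_x^p\partial_y^q f$, $d^{11}=d^{22}=0$, $d^{12}=-d^{21}=1$. **Sharipov's fields.** Put $$A=P_{0.2}-2Q_{1.1}+R_{2.0}+2PS_{1.0}+SP_{1.0}-3PR_{0.1}-3RP_{0.1}-3QR_{1.0}+6QQ_{0.1},$$ $$B=S_{2.0}-2R_{1.1}+Q_{0.2}-2SP_{0.1}-PS_{0.1}+3SQ_{1.0}+3QS_{1.0}+3RQ_{0.1}-6RR_{1.0},$$ $$G=-BB_{1.0}-3AB_{0.1}+4BA_{0.1}+3SA^2-6RBA+3QB^2,\quad H=-AA_{0.1}-3BA_{1.0}+4AB_{1.0}-3PB^2+6QAB-3RA^2,$$ and let $F$ be the real fifth root of $\frac13(AG+BH)$. Let $\alpha_1=A$, $\alpha_2=B$, $\alpha^i=\sum_k d^{ik}\alpha_k$. Where $A\ne0$ put $$N=-\frac{H}{3A},\quad \varphi_1=-3\frac{BP+A_{1.0}}{5A}+\frac35Q,\quad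 \varphi_2=3B\frac{BP+A_{1.0}}{5A^2}-3\frac{B_{1.0}+A_{0.1}+3BQ}{5A}+\frac65R,$$ $$\Omega=\frac56\sum_{i,j}\omega_{ij}d^{ij},\quad \omega_{ij}=\frac{\partial\varphi_i}{\partial x^j}-\frac{\partial\varphi_j}{\partial x^i},$$ $$M=-\frac{12BN(BP+A_{1.0})}{5A}+BN_{1.0}+\frac{24}5BNQ+\frac65NB_{1.0}+\frac65NA_{0.1}-AN_{0.1}-\frac{12}5ANR,$$ $$\gamma_1=\frac{6N(BP+A_{1.0})}{5A}-N_{1.0}-\frac65NQ-2\Omega A,$$ $$\gamma_2=-\frac{6BN(BP+A_{1.0})}{5A^2}+\frac{18NBQ}{5A}+\frac{6N(B_{1.0}+A_{0.1})}{5A}-N_{0.1}-\frac{12}5NR-2\Omega B,$$ and $\gamma^i=\sum_kd^{ik}\gamma_k$. (Where $A=0\neq B$ the analogous formulas with $B$ in the denominators are used; they are not needed on the class below, where $A\ne 0$.) The fields $\boldsymbol\alpha=(\alpha^1,\alpha^2)$ and $\boldsymbol\gamma=(\gamma^1,\gamma^2)$ have the weights $w_1=2$ and $w_2=3$. Let $\theta_{ijk}$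 be symmetric with $\theta_{111}=P$, $\theta_{112}=Q$, $\theta_{122}=R$, $\theta_{222}=S$, let $\theta^k_{ij}=\sum_rd^{kr}\theta_{rij}$, and let $\varGamma^k_{ij}=\theta^k_{ij}-\frac13(\varphi_i\delta^k_j+\varphi_j\delta^k_i)$ be the connection with curvature tensor $$R^k_{rij}=\partial_i\varGamma^k_{jr}-\partial_j\varGamma^k_{ir}+\sum_q(\varGamma^k_{iq}\varGamma^q_{jr}-\varGamma^k_{jq}\varGamma^q_{ir}).$$ Let $\mathbf R$ be the operator with matrix $R^k_q=\frac12\sum_{i,j}R^k_{qij}d^{ij}$. For a field $V$, a function $f$ of weight $m$ and a vector field $X$ of weight $m$ put $$\nabla_Vf=\sum_kV^k(\partial_kf+m\varphi_kf),\qquad (\nabla_VX)^i=\sum_kV^k\Bigl(\partial_kX^i+\sum_v\varGamma^i_{kv}X^v+m\varphi_kX^i\Bigr).$$ **Bagderina's quantities.** Put $a_0=Q_{1.0}-P_{0.1}+2PR-2Q^2$, $a_1=R_{1.0}-Q_{0.1}+PS-QR$, $a_2=S_{1.0}-R_{0.1}+2QS-2R^2$; $$\beta_1=\partial_xa_1-\partial_ya_0+Ra_0-2Qa_1+Pa_2,\qquad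 \beta_2=\partial_xa_2-\partial_ya_1+Sa_0-2Ra_1+Qa_2$$ (in fact $\beta_1=A$, $\beta_2=B$); $$g_{10}=\partial_x\beta_1-Q\beta_1+P\beta_2,\ \ g_{11}=\partial_x\beta_2-R\beta_1+Q\beta_2,\ \ g_{20}=\partial_y\beta_1-R\beta_1+Q\beta_2,\ \ g_{21}=\partial_y\beta_2-S\beta_1+R\beta_2;$$ $$\delta_{10}=\partial_xg_{10}-2Qg_{10}+P(g_{20}+g_{11})-5a_0\beta_1,\qquad \delta_{20}=\partial_xg_{20}-Rg_{10}+Pg_{21}-4a_1\beta_1-a_0\beta_2,$$ $$\delta_{30}=\partial_yg_{20}-Sg_{10}+Qg_{21}-4a_2\beta_1-a_1\beta_2,\qquad \delta_{11}=\partial_xg_{11}-Rg_{10}+Pg_{21}-a_1\beta_1-4a_0\beta_2;$$ $$\Gamma_0=3\beta_2g_{10}+\beta_1(g_{20}-4g_{11}),\qquad J_0=\beta_2^2g_{10}-\beta_1\beta_2(g_{20}+g_{11})+\beta_1^2g_{21};$$ $$j_0=\frac3{\beta_1}\Bigl(\frac{\beta_2}{\beta_1}\delta_{10}-\delta_{11}\Bigr)+\frac{6g_{10}}{\beta_1^2}\Bigl(g_{11}-\frac{\beta_2}{\beta_1}g_{10}\Bigr),$$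 $$j_1=\frac56\Bigl(2\beta_2\delta_{20}-\beta_1\delta_{30}-\frac{\beta_2^2}{\beta_1}\delta_{10}\Bigr)+\Bigl(g_{20}-\frac23g_{11}-\frac{\beta_2}{3\beta_1}g_{10}\Bigr)\Bigl(g_{20}+g_{11}-2\frac{\beta_2}{\beta_1}g_{10}\Bigr),$$ $$j_2=\frac1{\beta_1}\Bigl(\delta_{20}-\frac{\beta_2}{\beta_1}\delta_{10}\Bigr)+\frac{g_{10}}{5\beta_1^2}\Bigl(7\frac{\beta_2}{\beta_1}g_{10}-6g_{20}-g_{11}\Bigr),\qquad j_3=\frac35\Bigl(\frac{\delta_{10}}{\beta_1^3}-\frac{6g_{10}^2}{5\beta_1^4}\Bigr),$$ $$j_5=5\bigl(2j_1j_3+(j_2-j_0/6)^2\bigr).$$ **Theorem 7.1.** Assume that at all points of $U$ the equation belongs to ShrID1, i.e. $F=0$, $\boldsymbol\alpha\neq0$, $M\ne0$, and to BgdET2, i.e. $J_0=0$, $\beta_1\ne0$, $j_0\neq0$, $\Gamma_0\ne0$. Then: 1. There are functions $\Gamma^k_{ij}$ on $U$, and they are unique, such that $$\nabla_{\boldsymbol\alpha}\boldsymbol\alpha=\Gamma^1_{11}\boldsymbol\alpha+\Gamma^2_{11}\boldsymbol\gamma,\quad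 \nabla_{\boldsymbol\alpha}\boldsymbol\gamma=\Gamma^1_{12}\boldsymbol\alpha+\Gamma^2_{12}\boldsymbol\gamma,\quad \nabla_{\boldsymbol\gamma}\boldsymbol\alpha=\Gamma^1_{21}\boldsymbol\alpha+\Gamma^2_{21}\boldsymbol\gamma,\quad \nabla_{\boldsymbol\gamma}\boldsymbol\gamma=\Gamma^1_{22}\boldsymbol\alpha+\Gamma^2_{22}\boldsymbol\gamma.$$ 2. $j_5=-125\det\mathbf R+\frac{45}4\Omega^2$ on $U$. 3. $\mathbf R(\boldsymbol\alpha)=F^1_1\boldsymbol\alpha+F^2_1\boldsymbol\gamma$ and $\mathbf R(\boldsymbol\gamma)=F^1_2\boldsymbol\alpha+F^2_2\boldsymbol\gamma$ on $U$, where $$F^k_j=\frac1M\Bigl(\nabla_{\boldsymbol\alpha}\Gamma^k_{2j}-\nabla_{\boldsymbol\gamma}\Gamma^k_{1j}+\sum_{s=1}^2\bigl(\Gamma^s_{2j}\Gamma^k_{1s}-\Gamma^s_{1j}\Gamma^k_{2s}\bigr)-\sum_{s=1}^2(\Gamma^s_{12}-\Gamma^s_{21})\Gamma^k_{sj}\Bigr)+\frac35\,w_j\,\Omega\,\delta^k_j$$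 and $\Gamma^k_{ij}$ is differentiated as a pseudoscalar field of the weight $w_i+w_j-w_k$. 4. Consequently $j_5$ is expressed through $M$, $\Omega$, the eight functions $\Gamma^k_{ij}$ and their covariant derivatives along $\boldsymbol\alpha$ and $\boldsymbol\gamma$ by $$j_5=-125\,\bigl(F^1_1F^2_2-F^1_2F^2_1\bigr)+\frac{45}4\,\Omega^2\quad\text{on }U.$$ -/

import Mathlib

open scoped ContDiff

/-- Functions of the two coordinates `x = x¹`, `y = x²`; formulas are written in the ring of such
functions, with pointwise operations. -/
abbrev Fn := ℝ × ℝ → ℝ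

/-- The coefficients of the equation `y'' = P + 3 Q y' + 3 R (y')² + S (y')³`. -/
structure CubicODE where
  P : Fn
  Q : Fn
  R : Fn
  S : Fn

noncomputable section

/-- `∂f/∂x`. -/
def dx (f : Fn) : Fn := fun p => fderiv ℝ f p (1, 0)

/-- `∂f/∂y`. -/
def dy (f : Fn) : Fn := fun p => fderiv ℝ f p (0, 1)

/-- `∂f/∂xⁱ`; the index values `0, 1` of `Fin 2` stand for the coordinate numbers `1, 2`. -/
def pd (i : Fin 2) (f : Fn) : Fn := ![dx f, dy f] i

/-- The skew-symmetric matrix `d` with constant components. -/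
def dMat (i j : Fin 2) : ℝ := !![0, 1; -1, 0] i j

/-- The function given by `f` where `A ≠ 0` and by `g` where `A = 0`. -/
def piecewiseOn (A f g : Fn) : Fn := fun p => if A p ≠ 0 then f p else g p

namespace CubicODE

variable (e : CubicODE)

/-! ### Basic fields -/

def A : Fn :=
  dy (dy e.P) - 2 * dx (dy e.Q) + dx (dx e.R) + 2 * e.P * dx e.S + e.S * dx e.P
    - 3 * e.P * dy e.R - 3 * e.R * dy e.P - 3 * e.Q * dx e.R + 6 * e.Q * dy e.Q

def B : Fn :=
  dx (dx e.S) - 2 * dx (dy e.R) + dy (dy e.Q) - 2 * e.S * dy e.P - e.P * dy e.S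
    + 3 * e.S * dx e.Q + 3 * e.Q * dx e.S + 3 * e.R * dy e.Q - 6 * e.R * dx e.R

def G : Fn :=
  -e.B * dx e.B - 3 * e.A * dy e.B + 4 * e.B * dy e.A
    + 3 * e.S * e.A ^ 2 - 6 * e.R * e.B * e.A + 3 * e.Q * e.B ^ 2

def H : Fn :=
  -e.A * dy e.A - 3 * e.B * dx e.A + 4 * e.A * dx e.B
    - 3 * e.P * e.B ^ 2 + 6 * e.Q * e.A * e.B - 3 * e.R * e.A ^ 2

/-- The pseudoscalar field `F`: the real fifth root of `(A G + B H) / 3`. -/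
def F : Fn := fun p =>
  SignType.sign ((e.A p * e.G p + e.B p * e.H p) / 3)
    * |(e.A p * e.G p + e.B p * e.H p) / 3| ^ (1 / 5 : ℝ)

theorem F_pow_five (p : ℝ × ℝ) : 3 * e.F p ^ 5 = e.A p * e.G p + e.B p * e.H p := by
  have h3 : ∀ w : ℝ, (SignType.sign w * |w| ^ (1 / 5 : ℝ)) ^ 5 = w := by
    intro w
    rw [mul_pow, ← Real.rpow_natCast (|w| ^ (1 / 5 : ℝ)), ← Real.rpow_mul (abs_nonneg _)]
    rcases lt_trichotomy w 0 with h | h | h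
    · simp [sign_neg h, abs_of_neg h, Odd.neg_pow (by decide : Odd 5)]
    · simp [h]
    · simp [sign_pos h, abs_of_pos h]
  unfold F
  rw [h3]
  ring

/-- The pseudocovectorial field `α` (weight 1), `α₁ = A`, `α₂ = B`. -/
def alphaLow (i : Fin 2) : Fn := ![e.A, e.B] i

/-- The pseudovectorial field `α` (weight 2), `αⁱ = ∑ d^{ik} α_k`. -/
def alpha (i : Fin 2) : Fn := fun p => ∑ k, dMat i k * e.alphaLow k p

/-! ### Fields of the cases of intermediate degeneration

These are meaningful when `F = 0` and `α ≠ 0`. Where both `A` and `B` are nonzero, the two formulas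
that are given for each quantity agree. -/

def N : Fn := piecewiseOn e.A (-e.H / (3 * e.A)) (e.G / (3 * e.B))

def phi1 : Fn := piecewiseOn e.A
  (-3 * ((e.B * e.P + dx e.A) / (5 * e.A)) + 3 / 5 * e.Q)
  (-3 * e.A * ((e.A * e.S - dy e.B) / (5 * e.B ^ 2))
    - 3 * ((dy e.A + dx e.B - 3 * e.A * e.R) / (5 * e.B)) - 6 / 5 * e.Q)

def phi2 : Fn := piecewiseOn e.A
  (3 * e.B * ((e.B * e.P + dx e.A) / (5 * e.A ^ 2))
    - 3 * ((dx e.B + dy e.A + 3 * e.B * e.Q) / (5 * e.A)) + 6 / 5 * e.R)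
  (3 * ((e.A * e.S - dy e.B) / (5 * e.B)) - 3 / 5 * e.R)

def phi (i : Fin 2) : Fn := ![e.phi1, e.phi2] i

/-- `ω_{ij} = ∂φ_i/∂xʲ - ∂φ_j/∂xⁱ`. -/
def omega (i j : Fin 2) : Fn := pd j (e.phi i) - pd i (e.phi j)

/-- The pseudoscalar field `Ω` (weight 1). -/
def Omega : Fn := fun p => 5 / 6 * ∑ i, ∑ j, e.omega i j p * dMat i j

/-- The pseudoscalar field `M` (weight 4). -/
def M : Fn := piecewiseOn e.A
  (-(12 * e.B * e.N * (e.B * e.P + dx e.A) / (5 * e.A)) + e.B * dx e.N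
    + 24 / 5 * e.B * e.N * e.Q + 6 / 5 * e.N * dx e.B + 6 / 5 * e.N * dy e.A
    - e.A * dy e.N - 12 / 5 * e.A * e.N * e.R)
  (-(12 * e.A * e.N * (e.A * e.S - dy e.B) / (5 * e.B)) - e.A * dy e.N
    + 24 / 5 * e.A * e.N * e.R - 6 / 5 * e.N * dy e.A - 6 / 5 * e.N * dx e.B
    + e.B * dx e.N - 12 / 5 * e.B * e.N * e.Q)

def gamma1 : Fn := piecewiseOn e.A
  (6 * e.N * (e.B * e.P + dx e.A) / (5 * e.A) - dx e.N - 6 / 5 * e.N * e.Q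
    - 2 * e.Omega * e.A)
  (6 * e.A * e.N * (e.A * e.S - dy e.B) / (5 * e.B ^ 2) - 18 * e.N * e.A * e.R / (5 * e.B)
    + 6 * e.N * (dy e.A + dx e.B) / (5 * e.B) - dx e.N + 12 / 5 * e.N * e.Q
    - 2 * e.Omega * e.A)

def gamma2 : Fn := piecewiseOn e.A
  (-(6 * e.B * e.N * (e.B * e.P + dx e.A) / (5 * e.A ^ 2)) + 18 * e.N * e.B * e.Q / (5 * e.A)
    + 6 * e.N * (dx e.B + dy e.A) / (5 * e.A) - dy e.N - 12 / 5 * e.N * e.R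
    - 2 * e.Omega * e.B)
  (-(6 * e.N * (e.A * e.S - dy e.B) / (5 * e.B)) - dy e.N + 6 / 5 * e.N * e.R
    - 2 * e.Omega * e.B)

/-- The pseudocovectorial field `γ` (weight 2). -/
def gammaLow (i : Fin 2) : Fn := ![e.gamma1, e.gamma2] i

/-- The pseudovectorial field `γ` (weight 3), `γⁱ = ∑ d^{ik} γ_k`. -/
def gamma (i : Fin 2) : Fn := fun p => ∑ k, dMat i k * e.gammaLow k p

/-! ### Connection, curvature, covariant derivatives -/

/-- The symmetric array `θ_{ijk}` with `θ₁₁₁ = P`, `θ₁₁₂ = Q`, `θ₁₂₂ = R`, `θ₂₂₂ = S`. -/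
def thetaLow (i j k : Fin 2) : Fn :=
  ![![![e.P, e.Q], ![e.Q, e.R]], ![![e.Q, e.R], ![e.R, e.S]]] i j k

/-- `θᵏ_{ij} = ∑ d^{kr} θ_{rij}`. -/
def theta (k i j : Fin 2) : Fn := fun p => ∑ r, dMat k r * e.thetaLow r i j p

/-- The connection components `Γᵏ_{ij} = θᵏ_{ij} - (φ_i δᵏ_j + φ_j δᵏ_i) / 3` in the coordinates
`x, y`. -/
def conn (k i j : Fin 2) : Fn := fun p =>
  e.theta k i j p
    - (e.phi i p * (if k = j then 1 else 0) + e.phi j p * (if k = i then 1 else 0)) / 3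

/-- The curvature tensor `Rᵏ_{rij}`. -/
def curv (k r i j : Fin 2) : Fn := fun p =>
  pd i (e.conn k j r) p - pd j (e.conn k i r) p
    + ∑ q, e.conn k i q p * e.conn q j r p - ∑ q, e.conn k j q p * e.conn q i r p

/-- The matrix `Rᵏ_q` of the curvature operator, in the coordinates `x, y`. -/
def curvOp (p : ℝ × ℝ) : Matrix (Fin 2) (Fin 2) ℝ :=
  Matrix.of fun k q => 1 / 2 * ∑ i, ∑ j, e.curv k q i j p * dMat i j

/-- The covariant derivative `∇_V f` of a pseudoscalar field `f` of weight `m`. -/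
def covScalar (m : ℤ) (V : Fin 2 → Fn) (f : Fn) : Fn := fun p =>
  ∑ k, V k p * (pd k f p + m * e.phi k p * f p)

/-- The components of the covariant derivative `∇_V X` of a pseudovectorial field `X` of
weight `m`. -/
def covVector (m : ℤ) (V X : Fin 2 → Fn) (i : Fin 2) : Fn := fun p =>
  ∑ k, V k p * (pd k (X i) p + ∑ v, e.conn i k v p * X v p + m * e.phi k p * X i p)

/-- The pair of pseudovectorial fields `(α, γ)`. -/
def frame (i : Fin 2) : Fin 2 → Fn := ![e.alpha, e.gamma] i

end CubicODE

/-- The weights of the pseudovectorial fields `α` and `γ`. -/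
def frameWeight (i : Fin 2) : ℤ := ![2, 3] i

namespace CubicODE

variable (e : CubicODE)

/-- `Γ k i j = Γᵏ_{ij}` are on `U` coefficients of the expansions
`∇_α α = Γ¹₁₁ α + Γ²₁₁ γ`, `∇_α γ = Γ¹₁₂ α + Γ²₁₂ γ`,
`∇_γ α = Γ¹₂₁ α + Γ²₂₁ γ`, `∇_γ γ = Γ¹₂₂ α + Γ²₂₂ γ`. -/
def IsFrameCoeff (U : Set (ℝ × ℝ)) (Γ : Fin 2 → Fin 2 → Fin 2 → Fn) : Prop :=
  ∀ p ∈ U, ∀ i j s : Fin 2,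
    e.covVector (frameWeight j) (e.frame i) (e.frame j) s p = ∑ k, Γ k i j p * e.frame k s p

/-- The covariant derivative along `α` (`a = 0`) or `γ` (`a = 1`) of the coefficient `Γᵏ_{ij}`,
a pseudoscalar field whose weight is determined by the weights of `α` and `γ`. -/
def covFrameCoeff (Γ : Fin 2 → Fin 2 → Fin 2 → Fn) (a k i j : Fin 2) : Fn :=
  e.covScalar (frameWeight i + frameWeight j - frameWeight k) (e.frame a) (Γ k i j)

/-! ### Bagderina's quantities -/

def bgdAlpha0 : Fn := dx e.Q - dy e.P + 2 * e.P * e.R - 2 * e.Q ^ 2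

def bgdAlpha1 : Fn := dx e.R - dy e.Q + e.P * e.S - e.Q * e.R

def bgdAlpha2 : Fn := dx e.S - dy e.R + 2 * e.Q * e.S - 2 * e.R ^ 2

def bgdBeta1 : Fn :=
  dx e.bgdAlpha1 - dy e.bgdAlpha0 + e.R * e.bgdAlpha0 - 2 * e.Q * e.bgdAlpha1 + e.P * e.bgdAlpha2

def bgdBeta2 : Fn :=
  dx e.bgdAlpha2 - dy e.bgdAlpha1 + e.S * e.bgdAlpha0 - 2 * e.R * e.bgdAlpha1 + e.Q * e.bgdAlpha2

def bgdGamma10 : Fn := dx e.bgdBeta1 - e.Q * e.bgdBeta1 + e.P * e.bgdBeta2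

def bgdGamma11 : Fn := dx e.bgdBeta2 - e.R * e.bgdBeta1 + e.Q * e.bgdBeta2

def bgdGamma20 : Fn := dy e.bgdBeta1 - e.R * e.bgdBeta1 + e.Q * e.bgdBeta2

def bgdGamma21 : Fn := dy e.bgdBeta2 - e.S * e.bgdBeta1 + e.R * e.bgdBeta2

/-- Bagderina's quantity `Γ₀`. -/
def bgdCapGamma0 : Fn :=
  3 * e.bgdBeta2 * e.bgdGamma10 + e.bgdBeta1 * (e.bgdGamma20 - 4 * e.bgdGamma11)

def bgdDelta10 : Fn :=
  dx e.bgdGamma10 - 2 * e.Q * e.bgdGamma10 + e.P * (e.bgdGamma20 + e.bgdGamma11)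
    - 5 * e.bgdAlpha0 * e.bgdBeta1

def bgdDelta20 : Fn :=
  dx e.bgdGamma20 - e.R * e.bgdGamma10 + e.P * e.bgdGamma21
    - 4 * e.bgdAlpha1 * e.bgdBeta1 - e.bgdAlpha0 * e.bgdBeta2

def bgdDelta30 : Fn :=
  dy e.bgdGamma20 - e.S * e.bgdGamma10 + e.Q * e.bgdGamma21
    - 4 * e.bgdAlpha2 * e.bgdBeta1 - e.bgdAlpha1 * e.bgdBeta2

def bgdDelta11 : Fn :=
  dx e.bgdGamma11 - e.R * e.bgdGamma10 + e.P * e.bgdGamma21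
    - e.bgdAlpha1 * e.bgdBeta1 - 4 * e.bgdAlpha0 * e.bgdBeta2

/-- Bagderina's quantity `J₀`. -/
def bgdCapJ0 : Fn :=
  e.bgdBeta2 ^ 2 * e.bgdGamma10 - e.bgdBeta1 * e.bgdBeta2 * (e.bgdGamma20 + e.bgdGamma11)
    + e.bgdBeta1 ^ 2 * e.bgdGamma21

/-- Bagderina's quantity `j₀`. -/
def bgdj0 : Fn :=
  3 / e.bgdBeta1 * (e.bgdBeta2 / e.bgdBeta1 * e.bgdDelta10 - e.bgdDelta11)
    + 6 * e.bgdGamma10 / e.bgdBeta1 ^ 2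
      * (e.bgdGamma11 - e.bgdBeta2 / e.bgdBeta1 * e.bgdGamma10)

/-- Bagderina's quantity `j₁`. -/
def bgdj1 : Fn :=
  5 / 6 * (2 * e.bgdBeta2 * e.bgdDelta20 - e.bgdBeta1 * e.bgdDelta30
      - e.bgdBeta2 ^ 2 / e.bgdBeta1 * e.bgdDelta10)
    + (e.bgdGamma20 - 2 / 3 * e.bgdGamma11 - e.bgdBeta2 / (3 * e.bgdBeta1) * e.bgdGamma10)
      * (e.bgdGamma20 + e.bgdGamma11 - 2 * (e.bgdBeta2 / e.bgdBeta1) * e.bgdGamma10)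

/-- Bagderina's quantity `j₂`. -/
def bgdj2 : Fn :=
  1 / e.bgdBeta1 * (e.bgdDelta20 - e.bgdBeta2 / e.bgdBeta1 * e.bgdDelta10)
    + e.bgdGamma10 / (5 * e.bgdBeta1 ^ 2)
      * (7 * (e.bgdBeta2 / e.bgdBeta1) * e.bgdGamma10 - 6 * e.bgdGamma20 - e.bgdGamma11)

/-- Bagderina's quantity `j₃`. -/
def bgdj3 : Fn :=
  3 / 5 * (e.bgdDelta10 / e.bgdBeta1 ^ 3 - 6 * e.bgdGamma10 ^ 2 / (5 * e.bgdBeta1 ^ 4))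

/-- Bagderina's quantity `j₅`. -/
def bgdj5 : Fn := 5 * (2 * e.bgdj1 * e.bgdj3 + (e.bgdj2 - e.bgdj0 / 6) ^ 2)

/-! ### The two classes of equations -/

/-- The first case of intermediate degeneration in Sharipov's classification, on `U`. -/
structure ShrID1 (U : Set (ℝ × ℝ)) : Prop where
  F_eq_zero : ∀ p ∈ U, e.F p = 0
  alpha_ne_zero : ∀ p ∈ U, ∃ i, e.alphaLow i p ≠ 0
  M_ne_zero : ∀ p ∈ U, e.M p ≠ 0

/-- Bagderina's equations of type two, on `U`. -/
structure BgdET2 (U : Set (ℝ × ℝ)) : Prop where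
  J0_eq_zero : ∀ p ∈ U, e.bgdCapJ0 p = 0
  beta1_ne_zero : ∀ p ∈ U, e.bgdBeta1 p ≠ 0
  j0_ne_zero : ∀ p ∈ U, e.bgdj0 p ≠ 0
  capGamma0_ne_zero : ∀ p ∈ U, e.bgdCapGamma0 p ≠ 0

end CubicODE

/-! ### The expression for `j₅`

Functions of real numbers only: `M`, `Ω`, the values `Γ k i j` of the frame coefficients and the
values `D a k i j` of their covariant derivatives along `α` (`a = 0`) and `γ` (`a = 1`). -/

/-- The matrix `Fᵏ_j`. -/
def frameCurvMatrix (M Ω : ℝ) (Γ : Fin 2 → Fin 2 → Fin 2 → ℝ)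
    (D : Fin 2 → Fin 2 → Fin 2 → Fin 2 → ℝ) : Matrix (Fin 2) (Fin 2) ℝ :=
  Matrix.of fun k j =>
    (D 0 k 1 j - D 1 k 0 j + ∑ s, (Γ s 1 j * Γ k 0 s - Γ s 0 j * Γ k 1 s)
        - ∑ s, (Γ s 0 1 - Γ s 1 0) * Γ k s j) / M
      + (if k = j then frameWeight j * (3 / 5 * Ω) else 0)

/-- The expression of `j₅`. -/
def j5Expr (M Ω : ℝ) (Γ : Fin 2 → Fin 2 → Fin 2 → ℝ)
    (D : Fin 2 → Fin 2 → Fin 2 → Fin 2 → ℝ) : ℝ :=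
  -125 * (frameCurvMatrix M Ω Γ D).det + 45 / 4 * Ω ^ 2

end

/-! The result joins a polynomial identity in coordinates with the structure equation of a
connection in a moving frame.

Coordinates: since `β₁ = A ≠ 0`, put `t = B/A` and `(a, b) = d log A`. The `φ_i` become polynomials
in jets of `P, Q, R, S, t` and in `a, b`; `β`, `g`, `δ` become `A` times such polynomials in the
jets, and `A` drops out of `j₅`. The condition `J₀ = 0` turns into `t_y = t t_x + S - 3Rt + 3Qt² -
Pt³`, which says that the integral curves of `α` solve the equation. It eliminates `t_y` and `t_xy`,
while closedness of `(a, b)` gives `a_y = b_x`. The remaining jets can be treated as independent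
variables, and the formula for `j₅` (`bgdj5_eq`) is a polynomial identity in them.

Frame: `M` is the determinant of `(α, γ)` (`M_eqOn`), so `M ≠ 0` makes the pair a frame, and
Cramer's rule gives existence, uniqueness and smoothness of the coefficients. For a field of weight
`m` the commutator of covariant derivatives is `𝐑 - (3/5) m Ω` (`covGrad_commutator`): the
connection is torsion-free, and the weight terms contribute the curl of `φ`. Written in the frame
(`frame_commutator`), this says that `F` is the matrix of `𝐑` in the basis `α, γ`. The determinant
does not depend on the basis, so it may be substituted in the formula for `j₅`. -/

section Calculus

/-! ### Partial derivatives of smooth functions on an open set -/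

variable {U : Set (ℝ × ℝ)} {f g : Fn} {p : ℝ × ℝ}

theorem dx_eq_pd (f : Fn) : dx f = pd 0 f := rfl

theorem dy_eq_pd (f : Fn) : dy f = pd 1 f := rfl

theorem pd_apply (i : Fin 2) (f : Fn) (p : ℝ × ℝ) :
    pd i f p = fderiv ℝ f p ((![(1, 0), (0, 1)] : Fin 2 → ℝ × ℝ) i) := by
  fin_cases i <;> rfl

/-- Differentiation is local and `U` is open. This allows formulas that hold only on `U`, such as
those that divide by `A`, to be differentiated. -/
theorem pd_congr_of_eqOn (hU : IsOpen U) (h : Set.EqOn f g U) (i : Fin 2) :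
    Set.EqOn (pd i f) (pd i g) U := by
  intro p hp
  have : f =ᶠ[nhds p] g := Filter.eventuallyEq_of_mem (hU.mem_nhds hp) h
  rw [pd_apply, pd_apply, this.fderiv_eq]

theorem ContDiffOn.pd (hf : ContDiffOn ℝ ∞ f U) (hU : IsOpen U) (i : Fin 2) :
    ContDiffOn ℝ ∞ (pd i f) U := by
  have h : _root_.pd i f = fun p => fderiv ℝ f p ((![(1, 0), (0, 1)] : Fin 2 → ℝ × ℝ) i) :=
    funext fun p => pd_apply i f p
  rw [h]
  exact (hf.fderiv_of_isOpen hU (by simp)).clm_apply contDiffOn_const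

theorem ContDiffOn.differentiableAt_of_mem (hf : ContDiffOn ℝ ∞ f U) (hU : IsOpen U)
    (hp : p ∈ U) : DifferentiableAt ℝ f p :=
  (hf.contDiffAt (hU.mem_nhds hp)).differentiableAt (by simp)

theorem pd_comm (hf : ContDiffOn ℝ ∞ f U) (hU : IsOpen U) (hp : p ∈ U) (i j : Fin 2) :
    pd i (pd j f) p = pd j (pd i f) p := by
  have hs : IsSymmSndFDerivAt ℝ f p :=
    (hf.contDiffAt (hU.mem_nhds hp)).isSymmSndFDerivAt
      (by simpa using WithTop.coe_le_coe.2 (le_top (a := (2 : ℕ∞))))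
  have hd : DifferentiableAt ℝ (fderiv ℝ f) p :=
    ((hf.fderiv_of_isOpen (m := ∞) hU (by simp)).contDiffAt (hU.mem_nhds hp)).differentiableAt
      (by simp)
  have key : ∀ a b : Fin 2, pd a (pd b f) p =
      fderiv ℝ (fderiv ℝ f) p ((![(1, 0), (0, 1)] : Fin 2 → ℝ × ℝ) a)
        ((![(1, 0), (0, 1)] : Fin 2 → ℝ × ℝ) b) := by
    intro a b
    have h : pd b f = fun p => fderiv ℝ f p ((![(1, 0), (0, 1)] : Fin 2 → ℝ × ℝ) b) :=
      funext fun p => pd_apply b f p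
    rw [pd_apply, h, fderiv_clm_apply hd (differentiableAt_const _)]
    simp
  rw [key, key, hs.eq]

theorem pd_const (i : Fin 2) (c : ℝ) : pd i (fun _ => c) p = 0 := by
  simp [pd_apply]

theorem pd_add (i : Fin 2) (hf : DifferentiableAt ℝ f p) (hg : DifferentiableAt ℝ g p) :
    pd i (fun q => f q + g q) p = pd i f p + pd i g p := by
  simp [pd_apply, fderiv_fun_add hf hg]

theorem pd_sub (i : Fin 2) (hf : DifferentiableAt ℝ f p) (hg : DifferentiableAt ℝ g p) :
    pd i (fun q => f q - g q) p = pd i f p - pd i g p := by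
  simp [pd_apply, fderiv_fun_sub hf hg]

theorem pd_neg (i : Fin 2) : pd i (fun q => -f q) p = -pd i f p := by
  simp [pd_apply]

theorem pd_mul (i : Fin 2) (hf : DifferentiableAt ℝ f p) (hg : DifferentiableAt ℝ g p) :
    pd i (fun q => f q * g q) p = pd i f p * g p + f p * pd i g p := by
  simp [pd_apply, fderiv_fun_mul hf hg]
  ring

theorem pd_pow (i : Fin 2) (n : ℕ) (hf : DifferentiableAt ℝ f p) :
    pd i (fun q => f q ^ n) p = n * f p ^ (n - 1) * pd i f p := by
  simp [pd_apply, fderiv_fun_pow n hf]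

end Calculus

/-! ### Pointwise algebra of the structure equation in a frame -/

/-- The compatibility of the curvature of a connection with its coefficients in a frame `X`:
the commutator of the covariant derivatives along `X 0`, `X 1` of a field with covariant
gradient `n` and frame coefficients `G`. -/
theorem frame_commutator
    (X : Fin 2 → Fin 2 → ℝ) (dX : Fin 2 → Fin 2 → Fin 2 → ℝ) (c : Fin 2 → Fin 2 → Fin 2 → ℝ)
    (φ : Fin 2 → ℝ) (n : Fin 2 → Fin 2 → ℝ) (dn : Fin 2 → Fin 2 → Fin 2 → ℝ)
    (G : Fin 2 → Fin 2 → ℝ) (dG : Fin 2 → Fin 2 → Fin 2 → ℝ) (Γ : Fin 2 → Fin 2 → Fin 2 → ℝ)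
    (w : Fin 2 → ℝ) (m : ℝ) (ρ : Fin 2 → ℝ)
    (hc : ∀ k, c k 1 0 = c k 0 1)
    (hX : ∀ i j s, ∑ k, X i k * (dX k j s + ∑ v, c s k v * X j v + w j * φ k * X j s)
      = ∑ k, Γ k i j * X k s)
    (hn : ∀ i s, ∑ k, X i k * n k s = ∑ k, G k i * X k s)
    (hdn : ∀ l i s, ∑ k, (dX l i k * n k s + X i k * dn l k s)
      = ∑ k, (dG l k i * X k s + G k i * dX l k s))
    (hρ : ∀ s, dn 0 1 s + ∑ v, c s 0 v * n 1 v + m * φ 0 * n 1 s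
      - (dn 1 0 s + ∑ v, c s 1 v * n 0 v + m * φ 1 * n 0 s) = ρ s) (t : Fin 2) :
    ∑ k, (∑ l, X 0 l * (dG l k 1 + (w 1 + m - w k) * φ l * G k 1)
        - ∑ l, X 1 l * (dG l k 0 + (w 0 + m - w k) * φ l * G k 0)
        + ∑ s, (G s 1 * Γ k 0 s - G s 0 * Γ k 1 s)
        - ∑ s, (Γ s 0 1 - Γ s 1 0) * G k s) * X k t
      = (X 0 0 * X 1 1 - X 0 1 * X 1 0) * ρ t := by
  have e3 := fun l i => hdn l i t
  have e1 := fun i j => hX i j t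
  simp only [Fin.sum_univ_two] at *
  have hρt := hρ t
  have h00 := hX 0 1 0
  have h01 := hX 0 1 1
  have h10 := hX 1 0 0
  have h11 := hX 1 0 1
  rw [hc] at *
  -- The `e3` terms differentiate the expansion of `∇_{X 1} Y` along `X 0` and conversely; the `e1`
  -- terms remove the derivatives of the frame vectors. The `hn` terms with `c` and with `φ` supply
  -- the connection and weight parts. By symmetry of `c`, the differences `h00 - h10` and `h01 -
  -- h11` give the bracket term contracted with `n`.
  linear_combination
    -X 0 0 * e3 0 1 - X 0 1 * e3 1 1 + X 1 0 * e3 0 0 + X 1 1 * e3 1 0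
    - G 0 1 * e1 0 0 - G 1 1 * e1 0 1 + G 0 0 * e1 1 0 + G 1 0 * e1 1 1
    - (X 0 0 * c t 0 0 + X 0 1 * c t 0 1) * hn 1 0
    - (X 0 0 * c t 0 1 + X 0 1 * c t 1 1) * hn 1 1
    + (X 1 0 * c t 0 0 + X 1 1 * c t 0 1) * hn 0 0
    + (X 1 0 * c t 0 1 + X 1 1 * c t 1 1) * hn 0 1
    - (w 1 + m) * (X 0 0 * φ 0 + X 0 1 * φ 1) * hn 1 t
    + (w 0 + m) * (X 1 0 * φ 0 + X 1 1 * φ 1) * hn 0 t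
    + (Γ 0 0 1 - Γ 0 1 0) * hn 0 t + (Γ 1 0 1 - Γ 1 1 0) * hn 1 t
    + n 0 t * (h00 - h10) + n 1 t * (h01 - h11)
    + (X 0 0 * X 1 1 - X 0 1 * X 1 0) * hρt

/-! ### The ratio `t = B / A` and the logarithmic derivatives of `A` -/

namespace CubicODE

/-- An equation with smooth coefficients on an open set `U` where `A ≠ 0`. -/
structure IsRegularOn (e : CubicODE) (U : Set (ℝ × ℝ)) : Prop where
  isOpen : IsOpen U
  smooth_P : ContDiffOn ℝ ∞ e.P U
  smooth_Q : ContDiffOn ℝ ∞ e.Q U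
  smooth_R : ContDiffOn ℝ ∞ e.R U
  smooth_S : ContDiffOn ℝ ∞ e.S U
  A_ne_zero : ∀ p ∈ U, e.A p ≠ 0

/-- The ratio `B / A`. -/
noncomputable def ratio (e : CubicODE) : Fn := fun p => e.B p / e.A p

/-- The logarithmic derivatives of `A`. -/
noncomputable def logDerivA (e : CubicODE) (i : Fin 2) : Fn := fun p => pd i e.A p / e.A p

variable {e : CubicODE} {U : Set (ℝ × ℝ)} {p : ℝ × ℝ}

theorem A_eq (e : CubicODE) : e.A = fun q =>
    pd 1 (pd 1 e.P) q - 2 * pd 0 (pd 1 e.Q) q + pd 0 (pd 0 e.R) q + 2 * e.P q * pd 0 e.S q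
      + e.S q * pd 0 e.P q - 3 * e.P q * pd 1 e.R q - 3 * e.R q * pd 1 e.P q
      - 3 * e.Q q * pd 0 e.R q + 6 * e.Q q * pd 1 e.Q q := rfl

theorem B_eq (e : CubicODE) : e.B = fun q =>
    pd 0 (pd 0 e.S) q - 2 * pd 0 (pd 1 e.R) q + pd 1 (pd 1 e.Q) q - 2 * e.S q * pd 1 e.P q
      - e.P q * pd 1 e.S q + 3 * e.S q * pd 0 e.Q q + 3 * e.Q q * pd 0 e.S q
      + 3 * e.R q * pd 1 e.Q q - 6 * e.R q * pd 0 e.R q := rfl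

theorem IsRegularOn.smooth_A (h : e.IsRegularOn U) : ContDiffOn ℝ ∞ e.A U := by
  obtain ⟨hU, hP, hQ, hR, hS, -⟩ := h
  have := hP.pd hU; have := hQ.pd hU; have := hR.pd hU; have := hS.pd hU
  have := (hP.pd hU 1).pd hU 1; have := (hQ.pd hU 1).pd hU 0; have := (hR.pd hU 0).pd hU 0
  rw [A_eq]
  apply_rules [ContDiffOn.add, ContDiffOn.sub, ContDiffOn.mul, ContDiffOn.neg,
    ContDiffOn.pow, contDiffOn_const]

theorem IsRegularOn.smooth_B (h : e.IsRegularOn U) : ContDiffOn ℝ ∞ e.B U := by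
  obtain ⟨hU, hP, hQ, hR, hS, -⟩ := h
  have := hP.pd hU; have := hQ.pd hU; have := hR.pd hU; have := hS.pd hU
  have := (hS.pd hU 0).pd hU 0; have := (hR.pd hU 1).pd hU 0; have := (hQ.pd hU 1).pd hU 1
  rw [B_eq]
  apply_rules [ContDiffOn.add, ContDiffOn.sub, ContDiffOn.mul, ContDiffOn.neg,
    ContDiffOn.pow, contDiffOn_const]

theorem IsRegularOn.smooth_ratio (h : e.IsRegularOn U) : ContDiffOn ℝ ∞ e.ratio U :=
  h.smooth_B.div h.smooth_A h.A_ne_zero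

theorem IsRegularOn.smooth_logDerivA (h : e.IsRegularOn U) (i : Fin 2) :
    ContDiffOn ℝ ∞ (e.logDerivA i) U :=
  (h.smooth_A.pd h.isOpen i).div h.smooth_A h.A_ne_zero

theorem IsRegularOn.B_eqOn (h : e.IsRegularOn U) :
    Set.EqOn e.B (fun q => e.ratio q * e.A q) U := fun q hq => by
  have := h.A_ne_zero q hq
  simp only [ratio]
  field_simp

theorem IsRegularOn.pd_A (h : e.IsRegularOn U) (i : Fin 2) :
    Set.EqOn (pd i e.A) (fun q => e.logDerivA i q * e.A q) U := fun q hq => by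
  have := h.A_ne_zero q hq
  simp only [logDerivA]
  field_simp

theorem IsRegularOn.pd_B (h : e.IsRegularOn U) (i : Fin 2) :
    Set.EqOn (pd i e.B)
      (fun q => (pd i e.ratio q + e.ratio q * e.logDerivA i q) * e.A q) U := fun q hq => by
  rw [pd_congr_of_eqOn h.isOpen h.B_eqOn i hq,
    pd_mul i (h.smooth_ratio.differentiableAt_of_mem h.isOpen hq)
      (h.smooth_A.differentiableAt_of_mem h.isOpen hq), h.pd_A i hq]
  ring

/-- The logarithmic derivatives of `A` form a closed covector field. -/
theorem IsRegularOn.pd_logDerivA (h : e.IsRegularOn U) (hp : p ∈ U) :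
    pd 1 (e.logDerivA 0) p = pd 0 (e.logDerivA 1) p := by
  have hA := h.smooth_A
  have key : ∀ i j, pd i (pd j e.A) p = (pd i (e.logDerivA j) p
      + e.logDerivA j p * e.logDerivA i p) * e.A p := fun i j => by
    rw [pd_congr_of_eqOn h.isOpen (h.pd_A j) i hp,
      pd_mul i ((h.smooth_logDerivA j).differentiableAt_of_mem h.isOpen hp)
        (hA.differentiableAt_of_mem h.isOpen hp), h.pd_A i hp]
    ring
  have := pd_comm hA h.isOpen hp 1 0
  rw [key, key] at this
  have := mul_right_cancel₀ (h.A_ne_zero p hp) this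
  linarith

/-! ### Sharipov's fields in terms of the ratio and the logarithmic derivatives -/

theorem IsRegularOn.N_eqOn (h : e.IsRegularOn U) : Set.EqOn e.N (fun q =>
    -(e.A q / 3) * (-e.logDerivA 1 q + e.ratio q * e.logDerivA 0 q + 4 * pd 0 e.ratio q
      - 3 * e.P q * e.ratio q ^ 2 + 6 * e.Q q * e.ratio q - 3 * e.R q)) U := fun q hq => by
  have hA := h.A_ne_zero q hq
  simp only [N, piecewiseOn, if_pos hA, H, Pi.div_apply, Pi.neg_apply, Pi.mul_apply, Pi.add_apply,
    Pi.sub_apply, Pi.pow_apply, Pi.ofNat_apply, dx_eq_pd, dy_eq_pd, h.pd_A _ hq, h.pd_B _ hq,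
    h.B_eqOn hq]
  field_simp
  ring

theorem IsRegularOn.phi1_eqOn (h : e.IsRegularOn U) : Set.EqOn e.phi1 (fun q =>
    3 / 5 * (e.Q q - e.ratio q * e.P q - e.logDerivA 0 q)) U := fun q hq => by
  have hA := h.A_ne_zero q hq
  simp only [phi1, piecewiseOn, if_pos hA, Pi.div_apply, Pi.neg_apply, Pi.mul_apply,
    Pi.add_apply, Pi.ofNat_apply, dx_eq_pd, h.pd_A _ hq, h.B_eqOn hq]
  field_simp
  ring

theorem IsRegularOn.phi2_eqOn (h : e.IsRegularOn U) : Set.EqOn e.phi2 (fun q =>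
    3 / 5 * (e.ratio q ^ 2 * e.P q - pd 0 e.ratio q - e.logDerivA 1 q
      - 3 * e.ratio q * e.Q q + 2 * e.R q)) U := fun q hq => by
  have hA := h.A_ne_zero q hq
  simp only [phi2, piecewiseOn, if_pos hA, Pi.div_apply, Pi.mul_apply, Pi.sub_apply, Pi.pow_apply,
    Pi.add_apply, Pi.ofNat_apply, dx_eq_pd, dy_eq_pd, h.pd_A _ hq, h.pd_B _ hq, h.B_eqOn hq]
  field_simp
  ring

theorem IsRegularOn.gamma1_eqOn (h : e.IsRegularOn U) : Set.EqOn e.gamma1 (fun q =>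
    6 / 5 * e.N q * (e.ratio q * e.P q + e.logDerivA 0 q) - pd 0 e.N q - 6 / 5 * e.N q * e.Q q
      - 2 * e.Omega q * e.A q) U := fun q hq => by
  have hA := h.A_ne_zero q hq
  simp only [gamma1, piecewiseOn, if_pos hA, Pi.div_apply, Pi.mul_apply, Pi.sub_apply,
    Pi.add_apply, Pi.ofNat_apply, dx_eq_pd, h.pd_A _ hq, h.B_eqOn hq]
  field_simp

theorem IsRegularOn.gamma2_eqOn (h : e.IsRegularOn U) : Set.EqOn e.gamma2 (fun q =>
    -(6 / 5) * e.N q * e.ratio q * (e.ratio q * e.P q + e.logDerivA 0 q)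
      + 18 / 5 * e.N q * e.ratio q * e.Q q
      + 6 / 5 * e.N q * (pd 0 e.ratio q + e.ratio q * e.logDerivA 0 q + e.logDerivA 1 q)
      - pd 1 e.N q - 12 / 5 * e.N q * e.R q - 2 * e.Omega q * e.B q) U := fun q hq => by
  have hA := h.A_ne_zero q hq
  simp only [gamma2, piecewiseOn, if_pos hA, Pi.div_apply, Pi.mul_apply, Pi.sub_apply,
    Pi.neg_apply, Pi.pow_apply,
    Pi.add_apply, Pi.ofNat_apply, dx_eq_pd, dy_eq_pd, h.pd_A _ hq, h.pd_B _ hq, h.B_eqOn hq]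
  field_simp

theorem alpha_zero (e : CubicODE) : e.alpha 0 = e.B := by
  ext q; simp [alpha, alphaLow, dMat]

theorem alpha_one (e : CubicODE) : e.alpha 1 = fun q => -e.A q := by
  ext q; simp [alpha, alphaLow, dMat]

theorem gamma_zero (e : CubicODE) : e.gamma 0 = e.gamma2 := by
  ext q; simp [gamma, gammaLow, dMat]

theorem gamma_one (e : CubicODE) : e.gamma 1 = fun q => -e.gamma1 q := by
  ext q; simp [gamma, gammaLow, dMat]

/-- In `A γ₂ - B γ₁` the two terms with `Ω` cancel, and what is left is the formula for `M`. Hence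
`M ≠ 0` means that `α` and `γ` are linearly independent. -/
theorem IsRegularOn.M_eqOn (h : e.IsRegularOn U) : Set.EqOn e.M (fun q =>
    e.frame 0 0 q * e.frame 1 1 q - e.frame 0 1 q * e.frame 1 0 q) U := fun q hq => by
  have hA := h.A_ne_zero q hq
  change _ = e.alpha 0 q * e.gamma 1 q - e.alpha 1 q * e.gamma 0 q
  rw [alpha_zero, alpha_one, gamma_zero, gamma_one]
  simp only [h.gamma1_eqOn hq, h.gamma2_eqOn hq, M, piecewiseOn, if_pos hA, Pi.div_apply,
    Pi.mul_apply, Pi.sub_apply, Pi.neg_apply, Pi.add_apply, Pi.ofNat_apply, dx_eq_pd, dy_eq_pd,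
    h.pd_A _ hq, h.pd_B _ hq, h.B_eqOn hq]
  field_simp
  ring

theorem IsRegularOn.smooth_N (h : e.IsRegularOn U) : ContDiffOn ℝ ∞ e.N U := by
  refine ContDiffOn.congr ?_ h.N_eqOn
  have := h.smooth_A; have := h.smooth_ratio; have := h.smooth_logDerivA
  have := h.smooth_ratio.pd h.isOpen
  obtain ⟨hU, hP, hQ, hR, hS, -⟩ := h
  apply_rules [ContDiffOn.add, ContDiffOn.sub, ContDiffOn.mul, ContDiffOn.neg,
    ContDiffOn.pow, contDiffOn_const]

theorem IsRegularOn.smooth_phi (h : e.IsRegularOn U) (i : Fin 2) :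
    ContDiffOn ℝ ∞ (e.phi i) U := by
  have h1 := h.phi1_eqOn; have h2 := h.phi2_eqOn
  have := h.smooth_ratio; have := h.smooth_logDerivA
  have := h.smooth_ratio.pd h.isOpen
  obtain ⟨hU, hP, hQ, hR, hS, -⟩ := h
  match i with
  | 0 => exact ContDiffOn.congr (by
    apply_rules [ContDiffOn.add, ContDiffOn.sub, ContDiffOn.mul, ContDiffOn.neg,
      ContDiffOn.pow, contDiffOn_const]) h1
  | 1 => exact ContDiffOn.congr (by
    apply_rules [ContDiffOn.add, ContDiffOn.sub, ContDiffOn.mul, ContDiffOn.neg,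
      ContDiffOn.pow, contDiffOn_const]) h2

theorem Omega_eq (e : CubicODE) :
    e.Omega = fun q => 5 / 3 * (pd 1 (e.phi 0) q - pd 0 (e.phi 1) q) := by
  ext q
  simp [Omega, omega, dMat]
  ring

theorem IsRegularOn.smooth_Omega (h : e.IsRegularOn U) : ContDiffOn ℝ ∞ e.Omega U := by
  have := fun i j => (h.smooth_phi i).pd h.isOpen j
  rw [Omega_eq]
  apply_rules [ContDiffOn.add, ContDiffOn.sub, ContDiffOn.mul, ContDiffOn.neg,
    ContDiffOn.pow, contDiffOn_const]

theorem IsRegularOn.smooth_frame (h : e.IsRegularOn U) (i s : Fin 2) :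
    ContDiffOn ℝ ∞ (e.frame i s) U := by
  have h1 := h.gamma1_eqOn; have h2 := h.gamma2_eqOn
  have := h.smooth_A; have := h.smooth_B; have := h.smooth_ratio; have := h.smooth_logDerivA
  have := h.smooth_ratio.pd h.isOpen; have := h.smooth_N; have := h.smooth_N.pd h.isOpen
  have := h.smooth_Omega
  obtain ⟨hU, hP, hQ, hR, hS, -⟩ := h
  have hg1 : ContDiffOn ℝ ∞ e.gamma1 U := ContDiffOn.congr (by
    apply_rules [ContDiffOn.add, ContDiffOn.sub, ContDiffOn.mul, ContDiffOn.neg,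
      ContDiffOn.pow, contDiffOn_const]) h1
  match i, s with
  | 0, 0 =>
    change ContDiffOn ℝ ∞ (e.alpha 0) U
    rw [alpha_zero]
    apply_rules [ContDiffOn.add, ContDiffOn.sub, ContDiffOn.mul, ContDiffOn.neg,
      ContDiffOn.pow, contDiffOn_const]
  | 0, 1 =>
    change ContDiffOn ℝ ∞ (e.alpha 1) U
    rw [alpha_one]
    apply_rules [ContDiffOn.add, ContDiffOn.sub, ContDiffOn.mul, ContDiffOn.neg,
      ContDiffOn.pow, contDiffOn_const]
  | 1, 0 => change ContDiffOn ℝ ∞ (e.gamma 0) U; rw [gamma_zero]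
            refine ContDiffOn.congr (ContDiffOn.sub (ContDiffOn.sub ?_ ?_) ?_) h2 <;>
              apply_rules [ContDiffOn.add, ContDiffOn.sub, ContDiffOn.mul, ContDiffOn.neg,
                ContDiffOn.pow, contDiffOn_const]
  | 1, 1 =>
    change ContDiffOn ℝ ∞ (e.gamma 1) U
    rw [gamma_one]
    apply_rules [ContDiffOn.add, ContDiffOn.sub, ContDiffOn.mul, ContDiffOn.neg,
      ContDiffOn.pow, contDiffOn_const]

/-! ### Bagderina's quantities in terms of the ratio and the logarithmic derivatives -/

/-- Bagderina's `β₁` is `A`. -/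
theorem bgdBeta1_eqOn (hU : IsOpen U) (hP : ContDiffOn ℝ ∞ e.P U)
    (hQ : ContDiffOn ℝ ∞ e.Q U) (hR : ContDiffOn ℝ ∞ e.R U) (hS : ContDiffOn ℝ ∞ e.S U) :
    Set.EqOn e.bgdBeta1 e.A U := by
  intro q hq
  have dP := hP.differentiableAt_of_mem hU hq; have dQ := hQ.differentiableAt_of_mem hU hq
  have dR := hR.differentiableAt_of_mem hU hq; have dS := hS.differentiableAt_of_mem hU hq
  have dP' := fun i => (hP.pd hU i).differentiableAt_of_mem hU hq
  have dQ' := fun i => (hQ.pd hU i).differentiableAt_of_mem hU hq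
  have dR' := fun i => (hR.pd hU i).differentiableAt_of_mem hU hq
  have e1 : e.bgdAlpha1 = fun q => pd 0 e.R q - pd 1 e.Q q + e.P q * e.S q - e.Q q * e.R q := rfl
  have e0 : e.bgdAlpha0 = fun q => pd 0 e.Q q - pd 1 e.P q + 2 * e.P q * e.R q - 2 * e.Q q ^ 2 :=
    rfl
  rw [bgdBeta1, e1, e0]
  simp only [dx_eq_pd, dy_eq_pd, bgdAlpha2, A_eq, Pi.mul_apply, Pi.sub_apply,
    Pi.add_apply, Pi.ofNat_apply, Pi.pow_apply]
  -- Differentiability side goals are discharged recursively through the nested operations, hence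
  -- the raised depth.
  simp (config := { maxDischargeDepth := 40 }) only [pd_add, pd_sub, pd_mul, pd_pow, pd_const,
    DifferentiableAt.fun_add, DifferentiableAt.fun_sub, DifferentiableAt.fun_mul,
    DifferentiableAt.fun_pow, differentiableAt_const, dP, dQ, dR, dS, dP', dQ', dR']
  -- The derivatives of `a₁` and `a₀` contribute `-∂x∂yQ` and `-∂y∂xQ`, which together are the term
  -- `-2 Q_{1.1}` of `A`.
  rw [pd_comm hQ hU hq 1 0]
  push_cast
  ring

/-- Bagderina's `β₂` is `B`. -/
theorem bgdBeta2_eqOn (hU : IsOpen U) (hP : ContDiffOn ℝ ∞ e.P U)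
    (hQ : ContDiffOn ℝ ∞ e.Q U) (hR : ContDiffOn ℝ ∞ e.R U) (hS : ContDiffOn ℝ ∞ e.S U) :
    Set.EqOn e.bgdBeta2 e.B U := by
  intro q hq
  have dP := hP.differentiableAt_of_mem hU hq; have dQ := hQ.differentiableAt_of_mem hU hq
  have dR := hR.differentiableAt_of_mem hU hq; have dS := hS.differentiableAt_of_mem hU hq
  have dS' := fun i => (hS.pd hU i).differentiableAt_of_mem hU hq
  have dQ' := fun i => (hQ.pd hU i).differentiableAt_of_mem hU hq
  have dR' := fun i => (hR.pd hU i).differentiableAt_of_mem hU hq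
  have e1 : e.bgdAlpha1 = fun q => pd 0 e.R q - pd 1 e.Q q + e.P q * e.S q - e.Q q * e.R q := rfl
  have e2 : e.bgdAlpha2 = fun q => pd 0 e.S q - pd 1 e.R q + 2 * e.Q q * e.S q - 2 * e.R q ^ 2 :=
    rfl
  rw [bgdBeta2, e1, e2]
  simp only [dx_eq_pd, dy_eq_pd, bgdAlpha0, B_eq, Pi.mul_apply, Pi.sub_apply,
    Pi.add_apply, Pi.ofNat_apply, Pi.pow_apply]
  simp (config := { maxDischargeDepth := 40 }) only [pd_add, pd_sub, pd_mul, pd_pow, pd_const,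
    DifferentiableAt.fun_add, DifferentiableAt.fun_sub, DifferentiableAt.fun_mul,
    DifferentiableAt.fun_pow, differentiableAt_const, dP, dQ, dR, dS, dS', dQ', dR']
  rw [pd_comm hR hU hq 1 0]
  push_cast
  ring

theorem IsRegularOn.bgdBeta1_eqOn (h : e.IsRegularOn U) : Set.EqOn e.bgdBeta1 e.A U :=
  CubicODE.bgdBeta1_eqOn h.isOpen h.smooth_P h.smooth_Q h.smooth_R h.smooth_S

theorem IsRegularOn.bgdBeta2_eqOn (h : e.IsRegularOn U) : Set.EqOn e.bgdBeta2 e.B U :=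
  CubicODE.bgdBeta2_eqOn h.isOpen h.smooth_P h.smooth_Q h.smooth_R h.smooth_S


theorem IsRegularOn.bgdGamma10_eqOn (h : e.IsRegularOn U) : Set.EqOn e.bgdGamma10
    (fun q => e.A q * (e.logDerivA 0 q - e.Q q + e.ratio q * e.P q)) U := fun q hq => by
  simp only [bgdGamma10, dx_eq_pd, Pi.mul_apply, Pi.sub_apply, Pi.add_apply,
    pd_congr_of_eqOn h.isOpen h.bgdBeta1_eqOn 0 hq, h.bgdBeta1_eqOn hq, h.bgdBeta2_eqOn hq,
    h.B_eqOn hq, h.pd_A 0 hq]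
  ring

theorem IsRegularOn.bgdGamma11_eqOn (h : e.IsRegularOn U) : Set.EqOn e.bgdGamma11
    (fun q => e.A q * (pd 0 e.ratio q + e.ratio q * e.logDerivA 0 q - e.R q
      + e.ratio q * e.Q q)) U := fun q hq => by
  simp only [bgdGamma11, dx_eq_pd, Pi.mul_apply, Pi.sub_apply, Pi.add_apply,
    pd_congr_of_eqOn h.isOpen h.bgdBeta2_eqOn 0 hq, h.bgdBeta1_eqOn hq, h.bgdBeta2_eqOn hq,
    h.B_eqOn hq, h.pd_B 0 hq]
  ring

theorem IsRegularOn.bgdGamma20_eqOn (h : e.IsRegularOn U) : Set.EqOn e.bgdGamma20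
    (fun q => e.A q * (e.logDerivA 1 q - e.R q + e.ratio q * e.Q q)) U := fun q hq => by
  simp only [bgdGamma20, dy_eq_pd, Pi.mul_apply, Pi.sub_apply, Pi.add_apply,
    pd_congr_of_eqOn h.isOpen h.bgdBeta1_eqOn 1 hq, h.bgdBeta1_eqOn hq, h.bgdBeta2_eqOn hq,
    h.B_eqOn hq, h.pd_A 1 hq]
  ring

theorem IsRegularOn.bgdGamma21_eqOn (h : e.IsRegularOn U) : Set.EqOn e.bgdGamma21
    (fun q => e.A q * (pd 1 e.ratio q + e.ratio q * e.logDerivA 1 q - e.S q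
      + e.ratio q * e.R q)) U := fun q hq => by
  simp only [bgdGamma21, dy_eq_pd, Pi.mul_apply, Pi.sub_apply, Pi.add_apply,
    pd_congr_of_eqOn h.isOpen h.bgdBeta2_eqOn 1 hq, h.bgdBeta1_eqOn hq, h.bgdBeta2_eqOn hq,
    h.B_eqOn hq, h.pd_B 1 hq]
  ring

/-- The condition `J₀ = 0` as a differential equation for the ratio `B / A`. -/
theorem IsRegularOn.pd_one_ratio_eqOn (h : e.IsRegularOn U)
    (hJ : ∀ p ∈ U, e.bgdCapJ0 p = 0) : Set.EqOn (pd 1 e.ratio)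
    (fun q => e.ratio q * pd 0 e.ratio q + e.S q - 3 * e.R q * e.ratio q
      + 3 * e.Q q * e.ratio q ^ 2 - e.P q * e.ratio q ^ 3) U := fun q hq => by
  have hJq := hJ q hq
  have hA := h.A_ne_zero q hq
  simp only [bgdCapJ0, Pi.mul_apply, Pi.sub_apply, Pi.add_apply, Pi.pow_apply,
    h.bgdBeta1_eqOn hq, h.bgdBeta2_eqOn hq, h.B_eqOn hq, h.bgdGamma10_eqOn hq,
    h.bgdGamma11_eqOn hq, h.bgdGamma20_eqOn hq, h.bgdGamma21_eqOn hq] at hJq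
  -- After `B = t A`, the logarithmic derivatives cancel in `J₀`, which is `A³` times the difference
  -- of the two sides.
  have hA3 : e.A q ^ 3 ≠ 0 := pow_ne_zero 3 hA
  apply mul_left_cancel₀ hA3
  linear_combination hJq

/-! ### The connection and the curvature operator in coordinates -/

theorem conn_eq (e : CubicODE) :
    (e.conn 0 0 0 = fun q => e.Q q - 2 / 3 * e.phi 0 q) ∧
    (e.conn 0 0 1 = fun q => e.R q - 1 / 3 * e.phi 1 q) ∧
    (e.conn 0 1 0 = fun q => e.R q - 1 / 3 * e.phi 1 q) ∧
    (e.conn 0 1 1 = e.S) ∧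
    (e.conn 1 0 0 = fun q => -e.P q) ∧
    (e.conn 1 0 1 = fun q => -e.Q q - 1 / 3 * e.phi 0 q) ∧
    (e.conn 1 1 0 = fun q => -e.Q q - 1 / 3 * e.phi 0 q) ∧
    (e.conn 1 1 1 = fun q => -e.R q - 2 / 3 * e.phi 1 q) := by
  refine ⟨?_, ?_, ?_, ?_, ?_, ?_, ?_, ?_⟩ <;> ext q <;>
    simp [conn, theta, thetaLow, dMat] <;> ring

/-- The curvature tensor is skew in its last two indices, so half its contraction with `d` is the
single component `Rᵏ_{q12}`. -/
theorem curvOp_apply (e : CubicODE) (p : ℝ × ℝ) (k q : Fin 2) :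
    e.curvOp p k q = e.curv k q 0 1 p := by
  simp [curvOp, dMat, curv]
  ring

theorem IsRegularOn.curvOp_eq (h : e.IsRegularOn U) (hp : p ∈ U) :
    e.curvOp p = !![pd 0 e.R p - 1 / 3 * pd 0 (e.phi 1) p - pd 1 e.Q p + 2 / 3 * pd 1 (e.phi 0) p
        + (e.R p - 1 / 3 * e.phi 1 p) * (-e.Q p - 1 / 3 * e.phi 0 p) + e.S p * e.P p,
      pd 0 e.S p - pd 1 e.R p + 1 / 3 * pd 1 (e.phi 1) p
        + (e.Q p - 2 / 3 * e.phi 0 p) * e.S p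
        + (e.R p - 1 / 3 * e.phi 1 p) * (-e.R p - 2 / 3 * e.phi 1 p)
        - (e.R p - 1 / 3 * e.phi 1 p) * (e.R p - 1 / 3 * e.phi 1 p)
        - e.S p * (-e.Q p - 1 / 3 * e.phi 0 p);
      -pd 0 e.Q p - 1 / 3 * pd 0 (e.phi 0) p + pd 1 e.P p
        - e.P p * (e.R p - 1 / 3 * e.phi 1 p)
        + (-e.Q p - 1 / 3 * e.phi 0 p) * (-e.Q p - 1 / 3 * e.phi 0 p)
        - (-e.Q p - 1 / 3 * e.phi 0 p) * (e.Q p - 2 / 3 * e.phi 0 p)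
        + (-e.R p - 2 / 3 * e.phi 1 p) * e.P p,
      -pd 0 e.R p - 2 / 3 * pd 0 (e.phi 1) p + pd 1 e.Q p + 1 / 3 * pd 1 (e.phi 0) p
        - e.P p * e.S p
        - (-e.Q p - 1 / 3 * e.phi 0 p) * (e.R p - 1 / 3 * e.phi 1 p)] := by
  have dφ := fun i => (h.smooth_phi i).differentiableAt_of_mem h.isOpen hp
  have dQ := h.smooth_Q.differentiableAt_of_mem h.isOpen hp
  have dR := h.smooth_R.differentiableAt_of_mem h.isOpen hp
  obtain ⟨c000, c001, c010, c011, c100, c101, c110, c111⟩ := e.conn_eq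
  ext k q
  rw [curvOp_apply, curv]
  fin_cases k <;> fin_cases q <;>
    simp only [Fin.sum_univ_two, Fin.zero_eta, Fin.mk_one] <;>
    (try rw [c000]) <;> (try rw [c001]) <;> (try rw [c010]) <;> (try rw [c011]) <;>
    (try rw [c100]) <;> (try rw [c101]) <;> (try rw [c110]) <;> (try rw [c111]) <;>
    simp (config := { maxDischargeDepth := 40 }) [pd_sub, pd_mul, pd_const, pd_neg,
      DifferentiableAt.fun_mul, dφ, dQ, dR] <;>
    ring


/-! ### The formula for `j₅` as a polynomial identity -/

/-- Bagderina's `j₅` in terms of the quotients of `β₂`, `γ_{ij}`, `δ_{ij}` by `β₁ = A`. -/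
theorem bgdj5_of_quotients {A t u v w D10 D11 D20 D30 : ℝ} (hA : A ≠ 0)
    (h1 : e.bgdBeta1 p = A) (h2 : e.bgdBeta2 p = t * A)
    (h10 : e.bgdGamma10 p = A * u) (h11 : e.bgdGamma11 p = A * v) (h20 : e.bgdGamma20 p = A * w)
    (hD10 : e.bgdDelta10 p = A * D10) (hD11 : e.bgdDelta11 p = A * D11)
    (hD20 : e.bgdDelta20 p = A * D20) (hD30 : e.bgdDelta30 p = A * D30) :
    e.bgdj5 p = 5 * (2 * (5 / 6 * (2 * t * D20 - D30 - t ^ 2 * D10)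
          + (w - 2 / 3 * v - t / 3 * u) * (w + v - 2 * t * u)) * (3 / 5 * (D10 - 6 / 5 * u ^ 2))
        + (D20 - t * D10 + u / 5 * (7 * t * u - 6 * w - v)
          - (3 * (t * D10 - D11) + 6 * u * (v - t * u)) / 6) ^ 2) := by
  have e0 : e.bgdj0 p = 3 * (t * D10 - D11) + 6 * u * (v - t * u) := by
    simp only [bgdj0, Pi.mul_apply, Pi.add_apply, Pi.sub_apply, Pi.div_apply, Pi.pow_apply,
      Pi.ofNat_apply, h1, h2, h10, h11, hD10, hD11]
    field_simp
  -- `j₁` carries the factor `A²` and `j₃` the factor `A⁻²`, while `j₀` and `j₂` carry none, so `A`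
  -- disappears from `j₅`.
  have e1 : e.bgdj1 p = A ^ 2 * (5 / 6 * (2 * t * D20 - D30 - t ^ 2 * D10)
      + (w - 2 / 3 * v - t / 3 * u) * (w + v - 2 * t * u)) := by
    simp only [bgdj1, Pi.mul_apply, Pi.add_apply, Pi.sub_apply, Pi.div_apply, Pi.pow_apply,
      Pi.ofNat_apply, h1, h2, h10, h11, h20, hD10, hD20, hD30]
    field_simp
  have e2 : e.bgdj2 p = D20 - t * D10 + u / 5 * (7 * t * u - 6 * w - v) := by
    simp only [bgdj2, Pi.mul_apply, Pi.add_apply, Pi.sub_apply, Pi.div_apply, Pi.pow_apply,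
      Pi.ofNat_apply, h1, h2, h10, h11, h20, hD10, hD20]
    field_simp
  have e3 : e.bgdj3 p = 3 / 5 * (D10 - 6 / 5 * u ^ 2) / A ^ 2 := by
    simp only [bgdj3, Pi.mul_apply, Pi.sub_apply, Pi.div_apply, Pi.pow_apply,
      Pi.ofNat_apply, h1, h10, hD10]
    field_simp
  simp only [bgdj5, Pi.mul_apply, Pi.add_apply, Pi.sub_apply, Pi.div_apply, Pi.pow_apply,
      Pi.ofNat_apply, e0, e1, e2, e3]
  field_simp

/-- Bagderina's `j₅` through the curvature operator and `Ω`. -/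
theorem IsRegularOn.bgdj5_eq (h : e.IsRegularOn U) (hJ : ∀ p ∈ U, e.bgdCapJ0 p = 0)
    (hp : p ∈ U) : e.bgdj5 p = -125 * (e.curvOp p).det + 45 / 4 * e.Omega p ^ 2 := by
  have hU := h.isOpen
  have dP := h.smooth_P.differentiableAt_of_mem hU hp
  have dQ := h.smooth_Q.differentiableAt_of_mem hU hp
  have dR := h.smooth_R.differentiableAt_of_mem hU hp
  have dS := h.smooth_S.differentiableAt_of_mem hU hp
  have dA := h.smooth_A.differentiableAt_of_mem hU hp
  have dt := h.smooth_ratio.differentiableAt_of_mem hU hp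
  have da := fun i => (h.smooth_logDerivA i).differentiableAt_of_mem hU hp
  have dt' := fun i => (h.smooth_ratio.pd hU i).differentiableAt_of_mem hU hp
  have ht := h.pd_one_ratio_eqOn hJ hp
  -- Differentiating the equation for `t_y` in `x` expresses `t_xy`, which enters through the
  -- `y`-derivative of `φ₂`.
  have htx := pd_congr_of_eqOn hU (h.pd_one_ratio_eqOn hJ) 0 hp
  rw [pd_comm h.smooth_ratio hU hp 0 1] at htx
  have hφ0 : e.phi 0 p = _ := h.phi1_eqOn hp
  have hφ1 : e.phi 1 p = _ := h.phi2_eqOn hp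
  have hφ0x : pd 0 (e.phi 0) p = _ := pd_congr_of_eqOn hU h.phi1_eqOn 0 hp
  have hφ0y : pd 1 (e.phi 0) p = _ := pd_congr_of_eqOn hU h.phi1_eqOn 1 hp
  have hφ1x : pd 0 (e.phi 1) p = _ := pd_congr_of_eqOn hU h.phi2_eqOn 0 hp
  have hφ1y : pd 1 (e.phi 1) p = _ := pd_congr_of_eqOn hU h.phi2_eqOn 1 hp
  have h1 := h.bgdBeta1_eqOn hp
  have h2 := (h.bgdBeta2_eqOn hp).trans (h.B_eqOn hp)
  have h10 := h.bgdGamma10_eqOn hp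
  have h11 := h.bgdGamma11_eqOn hp
  have h20 := h.bgdGamma20_eqOn hp
  have h21 := h.bgdGamma21_eqOn hp
  have h10x := pd_congr_of_eqOn hU h.bgdGamma10_eqOn 0 hp
  have h11x := pd_congr_of_eqOn hU h.bgdGamma11_eqOn 0 hp
  have h20x := pd_congr_of_eqOn hU h.bgdGamma20_eqOn 0 hp
  have h20y := pd_congr_of_eqOn hU h.bgdGamma20_eqOn 1 hp
  simp (config := { maxDischargeDepth := 40 }) only [pd_add, pd_sub, pd_mul, pd_pow, pd_const,
    DifferentiableAt.fun_add, DifferentiableAt.fun_sub, DifferentiableAt.fun_mul,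
    DifferentiableAt.fun_pow, differentiableAt_const, dP, dQ, dR, dS, dA, dt, da, dt', h.pd_A _ hp,
    h.pd_logDerivA hp] at htx hφ0x hφ0y hφ1x hφ1y h10x h11x h20x h20y
  rw [htx] at hφ1y
  simp only [ht] at hφ0y hφ1y h21 h20y
  have hj := fun D10 D11 D20 D30 => bgdj5_of_quotients (D10 := D10) (D11 := D11) (D20 := D20)
    (D30 := D30) (h.A_ne_zero p hp) h1 h2 h10 h11 h20
  -- The four arguments are `δ₁₀, δ₁₁, δ₂₀, δ₃₀` divided by `A`. In each, the first summand comes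
  -- from differentiating the factor `A` of the corresponding `g`.
  rw [hj (e.logDerivA 0 p * (e.logDerivA 0 p - e.Q p + e.ratio p * e.P p)
      + (pd 0 (e.logDerivA 0) p - pd 0 e.Q p + pd 0 e.ratio p * e.P p + e.ratio p * pd 0 e.P p)
      - 2 * e.Q p * (e.logDerivA 0 p - e.Q p + e.ratio p * e.P p)
      + e.P p * (e.logDerivA 1 p - e.R p + e.ratio p * e.Q p
        + (pd 0 e.ratio p + e.ratio p * e.logDerivA 0 p - e.R p + e.ratio p * e.Q p))
      - 5 * (pd 0 e.Q p - pd 1 e.P p + 2 * e.P p * e.R p - 2 * e.Q p ^ 2))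
    (e.logDerivA 0 p * (pd 0 e.ratio p + e.ratio p * e.logDerivA 0 p - e.R p + e.ratio p * e.Q p)
      + (pd 0 (pd 0 e.ratio) p + pd 0 e.ratio p * e.logDerivA 0 p
        + e.ratio p * pd 0 (e.logDerivA 0) p - pd 0 e.R p + pd 0 e.ratio p * e.Q p
        + e.ratio p * pd 0 e.Q p)
      - e.R p * (e.logDerivA 0 p - e.Q p + e.ratio p * e.P p)
      + e.P p * (pd 1 e.ratio p + e.ratio p * e.logDerivA 1 p - e.S p + e.ratio p * e.R p)
      - (pd 0 e.R p - pd 1 e.Q p + e.P p * e.S p - e.Q p * e.R p)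
      - 4 * (pd 0 e.Q p - pd 1 e.P p + 2 * e.P p * e.R p - 2 * e.Q p ^ 2) * e.ratio p)
    (e.logDerivA 0 p * (e.logDerivA 1 p - e.R p + e.ratio p * e.Q p)
      + (pd 0 (e.logDerivA 1) p - pd 0 e.R p + pd 0 e.ratio p * e.Q p + e.ratio p * pd 0 e.Q p)
      - e.R p * (e.logDerivA 0 p - e.Q p + e.ratio p * e.P p)
      + e.P p * (pd 1 e.ratio p + e.ratio p * e.logDerivA 1 p - e.S p + e.ratio p * e.R p)
      - 4 * (pd 0 e.R p - pd 1 e.Q p + e.P p * e.S p - e.Q p * e.R p)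
      - (pd 0 e.Q p - pd 1 e.P p + 2 * e.P p * e.R p - 2 * e.Q p ^ 2) * e.ratio p)
    (e.logDerivA 1 p * (e.logDerivA 1 p - e.R p + e.ratio p * e.Q p)
      + (pd 1 (e.logDerivA 1) p - pd 1 e.R p + pd 1 e.ratio p * e.Q p + e.ratio p * pd 1 e.Q p)
      - e.S p * (e.logDerivA 0 p - e.Q p + e.ratio p * e.P p)
      + e.Q p * (pd 1 e.ratio p + e.ratio p * e.logDerivA 1 p - e.S p + e.ratio p * e.R p)
      - 4 * (pd 0 e.S p - pd 1 e.R p + 2 * e.Q p * e.S p - 2 * e.R p ^ 2)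
      - (pd 0 e.R p - pd 1 e.Q p + e.P p * e.S p - e.Q p * e.R p) * e.ratio p)
    ?_ ?_ ?_ ?_]
  · rw [h.curvOp_eq hp, Matrix.det_fin_two_of, Omega_eq]
    simp only [hφ0, hφ1, hφ0x, hφ0y, hφ1x, hφ1y, ht]
    push_cast
    -- No relation among these jets is needed any more: `t_y`, `t_xy` and `a_y` have been
    -- eliminated.
    generalize e.P p = P, e.Q p = Q, e.R p = R, e.S p = S, pd 0 e.P p = Px, pd 1 e.P p = Py,
      pd 0 e.Q p = Qx, pd 1 e.Q p = Qy, pd 0 e.R p = Rx, pd 1 e.R p = Ry, pd 0 e.S p = Sx,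
      pd 1 e.S p = Sy, e.ratio p = t, pd 0 e.ratio p = tx, pd 0 (pd 0 e.ratio) p = txx,
      e.logDerivA 0 p = a, e.logDerivA 1 p = b, pd 0 (e.logDerivA 0) p = ax,
      pd 0 (e.logDerivA 1) p = bx, pd 1 (e.logDerivA 1) p = bY
    ring
  all_goals
    simp only [bgdDelta10, bgdDelta11, bgdDelta20, bgdDelta30, dx_eq_pd, dy_eq_pd, Pi.mul_apply,
      Pi.sub_apply, Pi.add_apply, Pi.ofNat_apply, h10x, h11x, h20x, h20y, h10, h11, h20, h21, h1,
      h2, bgdAlpha0, bgdAlpha1, bgdAlpha2, Pi.pow_apply, ht]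
    ring

/-! ### The frame `(α, γ)` and the curvature operator in it -/

/-- The components `∇_k Yˢ` of the covariant gradient of a field `Y` of weight `m`. -/
noncomputable def covGrad (e : CubicODE) (m : ℤ) (Y : Fin 2 → Fn) (k s : Fin 2) : Fn := fun p =>
  pd k (Y s) p + ∑ v, e.conn s k v p * Y v p + m * e.phi k p * Y s p

/-- The coefficients of the covariant derivatives of `α`, `γ`, given by Cramer's rule. -/
noncomputable def frameCoeff (e : CubicODE) (k i j : Fin 2) : Fn := fun p =>
  ![e.covVector (frameWeight j) (e.frame i) (e.frame j) 0 p * e.frame 1 1 p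
      - e.covVector (frameWeight j) (e.frame i) (e.frame j) 1 p * e.frame 1 0 p,
    e.frame 0 0 p * e.covVector (frameWeight j) (e.frame i) (e.frame j) 1 p
      - e.frame 0 1 p * e.covVector (frameWeight j) (e.frame i) (e.frame j) 0 p] k / e.M p

theorem covVector_eq (e : CubicODE) (m : ℤ) (V Y : Fin 2 → Fn) (s : Fin 2) :
    e.covVector m V Y s = fun p => ∑ k, V k p * e.covGrad m Y k s p := rfl

/-- For fixed `i, j` the expansion is a linear system of two equations with determinant `M`. Besides
existence and uniqueness, this transfers smoothness from the Cramer quotients to any admissible `Γ`.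
-/
theorem IsRegularOn.isFrameCoeff_iff (h : e.IsRegularOn U) (hM : ∀ p ∈ U, e.M p ≠ 0)
    {Γ : Fin 2 → Fin 2 → Fin 2 → Fn} :
    e.IsFrameCoeff U Γ ↔ ∀ k i j, Set.EqOn (Γ k i j) (e.frameCoeff k i j) U := by
  have hM' : ∀ p ∈ U, e.M p = _ := fun p hp => h.M_eqOn hp
  constructor
  · intro hΓ k i j p hp
    have h0 := hΓ p hp i j 0
    have h1 := hΓ p hp i j 1
    rw [Fin.sum_univ_two] at h0 h1
    simp only [frameCoeff, h0, h1]
    rw [eq_div_iff (hM p hp), hM' p hp]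
    fin_cases k
    · simp only [Fin.zero_eta, Matrix.cons_val_zero]
      ring
    · simp only [Fin.mk_one, Matrix.cons_val_one, Matrix.cons_val_zero]
      ring
  · intro hΓ p hp i j s
    rw [Fin.sum_univ_two, hΓ 0 i j hp, hΓ 1 i j hp]
    have hMp := hM p hp
    simp only [frameCoeff, Matrix.cons_val_zero, Matrix.cons_val_one]
    field_simp
    rw [hM' p hp]
    fin_cases s
    · simp only [Fin.zero_eta]
      ring
    · simp only [Fin.mk_one]
      ring

/-- The connection is torsion-free, which keeps first derivatives of the field out of the Ricci
identity. -/
theorem conn_symm (e : CubicODE) (k : Fin 2) : e.conn k 1 0 = e.conn k 0 1 := by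
  obtain ⟨-, c001, c010, -, -, c101, c110, -⟩ := e.conn_eq
  fin_cases k
  · exact c010.trans c001.symm
  · exact c110.trans c101.symm

theorem IsRegularOn.smooth_conn (h : e.IsRegularOn U) (k i j : Fin 2) :
    ContDiffOn ℝ ∞ (e.conn k i j) U := by
  obtain ⟨c000, c001, c010, c011, c100, c101, c110, c111⟩ := e.conn_eq
  have := h.smooth_phi
  obtain ⟨hU, hP, hQ, hR, hS, -⟩ := h
  match k, i, j with
  | 0, 0, 0 => rw [c000]; apply_rules [ContDiffOn.sub, ContDiffOn.mul, contDiffOn_const]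
  | 0, 0, 1 => rw [c001]; apply_rules [ContDiffOn.sub, ContDiffOn.mul, contDiffOn_const]
  | 0, 1, 0 => rw [c010]; apply_rules [ContDiffOn.sub, ContDiffOn.mul, contDiffOn_const]
  | 0, 1, 1 => rw [c011]; exact hS
  | 1, 0, 0 => rw [c100]; exact hP.neg
  | 1, 0, 1 =>
    rw [c101]; apply_rules [ContDiffOn.sub, ContDiffOn.mul, contDiffOn_const, ContDiffOn.neg]
  | 1, 1, 0 =>
    rw [c110]; apply_rules [ContDiffOn.sub, ContDiffOn.mul, contDiffOn_const, ContDiffOn.neg]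
  | 1, 1, 1 =>
    rw [c111]; apply_rules [ContDiffOn.sub, ContDiffOn.mul, contDiffOn_const, ContDiffOn.neg]

theorem covGrad_eq (e : CubicODE) (m : ℤ) (Y : Fin 2 → Fn) (k s : Fin 2) :
    e.covGrad m Y k s = fun p => pd k (Y s) p + (e.conn s k 0 p * Y 0 p + e.conn s k 1 p * Y 1 p)
      + (m : ℝ) * e.phi k p * Y s p := by
  ext p
  rw [covGrad, Fin.sum_univ_two]

theorem IsRegularOn.smooth_covGrad (h : e.IsRegularOn U) {Y : Fin 2 → Fn}
    (hY : ∀ s, ContDiffOn ℝ ∞ (Y s) U) (m : ℤ) (k s : Fin 2) :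
    ContDiffOn ℝ ∞ (e.covGrad m Y k s) U := by
  have hY' := (hY s).pd h.isOpen k
  have hc := h.smooth_conn s k
  have hφ := h.smooth_phi k
  rw [covGrad_eq]
  exact (hY'.add (((hc 0).mul (hY 0)).add ((hc 1).mul (hY 1)))).add
    ((contDiffOn_const.mul hφ).mul (hY s))

theorem IsRegularOn.smooth_covVector (h : e.IsRegularOn U) {V Y : Fin 2 → Fn}
    (hV : ∀ s, ContDiffOn ℝ ∞ (V s) U) (hY : ∀ s, ContDiffOn ℝ ∞ (Y s) U) (m : ℤ) (s : Fin 2) :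
    ContDiffOn ℝ ∞ (e.covVector m V Y s) U := by
  rw [covVector_eq]
  exact ContDiffOn.sum fun k _ => (hV k).mul (h.smooth_covGrad hY m k s)

theorem IsRegularOn.smooth_M (h : e.IsRegularOn U) : ContDiffOn ℝ ∞ e.M U :=
  ContDiffOn.congr (((h.smooth_frame 0 0).mul (h.smooth_frame 1 1)).sub
    ((h.smooth_frame 0 1).mul (h.smooth_frame 1 0))) h.M_eqOn

theorem IsRegularOn.smooth_frameCoeff (h : e.IsRegularOn U) (hM : ∀ p ∈ U, e.M p ≠ 0)
    (k i j : Fin 2) : ContDiffOn ℝ ∞ (e.frameCoeff k i j) U := by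
  have hX := h.smooth_frame
  have hn := h.smooth_covVector (hX i) (hX j) (frameWeight j)
  refine ContDiffOn.div ?_ h.smooth_M hM
  match k with
  | 0 => exact ((hn 0).mul (hX 1 1)).sub ((hn 1).mul (hX 1 0))
  | 1 => exact ((hX 0 0).mul (hn 1)).sub ((hX 0 1).mul (hn 0))

/-- The Ricci identity for a field of weight `m`. -/
theorem IsRegularOn.covGrad_commutator (h : e.IsRegularOn U) {Y : Fin 2 → Fn}
    (hY : ∀ s, ContDiffOn ℝ ∞ (Y s) U) (m : ℤ) (hp : p ∈ U) (s : Fin 2) :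
    pd 0 (e.covGrad m Y 1 s) p + ∑ v, e.conn s 0 v p * e.covGrad m Y 1 v p
        + m * e.phi 0 p * e.covGrad m Y 1 s p
      - (pd 1 (e.covGrad m Y 0 s) p + ∑ v, e.conn s 1 v p * e.covGrad m Y 0 v p
        + m * e.phi 1 p * e.covGrad m Y 0 s p)
      = ∑ r, e.curvOp p s r * Y r p - 3 / 5 * m * e.Omega p * Y s p := by
  have hU := h.isOpen
  have dφ := fun i => (h.smooth_phi i).differentiableAt_of_mem hU hp
  have dc := fun k i j => (h.smooth_conn k i j).differentiableAt_of_mem hU hp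
  have dY := fun i => (hY i).differentiableAt_of_mem hU hp
  have dY' := fun i j => ((hY i).pd hU j).differentiableAt_of_mem hU hp
  rw [covGrad_eq e m Y 1 s, covGrad_eq e m Y 0 s]
  simp (config := { maxDischargeDepth := 40 }) only [pd_add, pd_mul, pd_const,
    DifferentiableAt.fun_add, DifferentiableAt.fun_mul, differentiableAt_const, dφ, dc, dY, dY',
    Fin.sum_univ_two, covGrad_eq, curvOp_apply, curv, Omega_eq, conn_symm]
  -- With second derivatives of `Y` cancelled, the weight terms leave `m (∂x φ₂ - ∂y φ₁) = -(3/5) m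
  -- Ω`.
  rw [pd_comm (hY s) hU hp 0 1]
  ring

/-- The curvature operator in the frame `(α, γ)`. -/
theorem IsRegularOn.curvOp_mulVec_frame (h : e.IsRegularOn U) (hM : ∀ p ∈ U, e.M p ≠ 0)
    {Γ : Fin 2 → Fin 2 → Fin 2 → Fn} (hΓ : e.IsFrameCoeff U Γ) (hp : p ∈ U) (j s : Fin 2) :
    (e.curvOp p).mulVec (fun q => e.frame j q p) s =
      ∑ k, frameCurvMatrix (e.M p) (e.Omega p) (fun k i j => Γ k i j p)
        (fun a k i j => e.covFrameCoeff Γ a k i j p) k j * e.frame k s p := by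
  have hU := h.isOpen
  have hX := h.smooth_frame
  have dX := fun i s => (hX i s).differentiableAt_of_mem hU hp
  have hn := fun k s => h.smooth_covGrad (hX j) (frameWeight j) k s
  have dn := fun k s => (hn k s).differentiableAt_of_mem hU hp
  have dΓ : ∀ k i, DifferentiableAt ℝ (Γ k i j) p := fun k i =>
    ((h.smooth_frameCoeff hM k i j).congr
      ((h.isFrameCoeff_iff hM).1 hΓ k i j)).differentiableAt_of_mem hU hp
  -- The differentiated field is the frame vector `j` itself, so its weight is `w_j` and its
  -- coefficients `G k i` are `Γ k i j`.
  have key := frame_commutator (fun i k => e.frame i k p) (fun l i k => pd l (e.frame i k) p)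
    (fun k i j => e.conn k i j p) (fun k => e.phi k p)
    (fun k s => e.covGrad (frameWeight j) (e.frame j) k s p)
    (fun l k s => pd l (e.covGrad (frameWeight j) (e.frame j) k s) p)
    (fun k i => Γ k i j p) (fun l k i => pd l (Γ k i j) p) (fun k i j => Γ k i j p)
    (fun i => (frameWeight i : ℝ)) (frameWeight j) _ (fun k => by rw [conn_symm])
    (fun i i' s => hΓ p hp i i' s) (fun i s => hΓ p hp i j s) ?_
    (fun s => h.covGrad_commutator (hX j) (frameWeight j) hp s) s
  · have hMp := hM p hp
    have hdet : e.M p = e.frame 0 0 p * e.frame 1 1 p - e.frame 0 1 p * e.frame 1 0 p :=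
      h.M_eqOn hp
    rw [← hdet] at key
    have hsum : ∑ k, e.curvOp p s k * e.frame j k p
        = (e.curvOp p).mulVec (fun q => e.frame j q p) s := rfl
    rw [hsum] at key
    have hδ : ∑ k, (if k = j then (frameWeight j : ℝ) * (3 / 5 * e.Omega p) else 0)
        * e.frame k s p = 3 / 5 * frameWeight j * e.Omega p * e.frame j s p := by
      simp only [ite_mul, zero_mul, Finset.sum_ite_eq', Finset.mem_univ, if_true]
      ring
    simp only [frameCurvMatrix, Matrix.of_apply, add_mul, Finset.sum_add_distrib, hδ]
    -- The term `-(3/5) w_j Ω` of the Ricci identity, moved to the other side, is the diagonal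
    -- correction in `F`.
    rw [← sub_eq_iff_eq_add]
    apply mul_left_cancel₀ hMp
    rw [← key, Finset.mul_sum]
    refine Finset.sum_congr rfl fun k _ => ?_
    rw [← mul_assoc, mul_div_cancel₀ _ hMp]
    simp only [covFrameCoeff, covScalar]
    push_cast
    ring
  -- The differentiated expansion: both sides agree on the open set `U`, so their partial
  -- derivatives agree at `p`.
  · intro l i s
    have hE : Set.EqOn
        (fun q => e.frame i 0 q * e.covGrad (frameWeight j) (e.frame j) 0 s q
          + e.frame i 1 q * e.covGrad (frameWeight j) (e.frame j) 1 s q)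
        (fun q => Γ 0 i j q * e.frame 0 s q + Γ 1 i j q * e.frame 1 s q) U := fun q hq => by
      have := hΓ q hq i j s
      rw [covVector_eq] at this
      simpa only [Fin.sum_univ_two] using this
    have := pd_congr_of_eqOn hU hE l hp
    simp (config := { maxDischargeDepth := 40 }) only [pd_add, pd_mul,
      DifferentiableAt.fun_mul, dX, dn, dΓ] at this
    simpa only [Fin.sum_univ_two] using this

/-- With `T` the matrix whose columns are `α` and `γ`, the frame identity reads `𝐑 T = T F`, and
`det T = M ≠ 0` can be cancelled. -/
theorem IsRegularOn.det_curvOp (h : e.IsRegularOn U) (hM : ∀ p ∈ U, e.M p ≠ 0)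
    {Γ : Fin 2 → Fin 2 → Fin 2 → Fn} (hΓ : e.IsFrameCoeff U Γ) (hp : p ∈ U) :
    (e.curvOp p).det = (frameCurvMatrix (e.M p) (e.Omega p) (fun k i j => Γ k i j p)
        (fun a k i j => e.covFrameCoeff Γ a k i j p)).det := by
  set T : Matrix (Fin 2) (Fin 2) ℝ := Matrix.of fun s k => e.frame k s p with hT
  have hdet : T.det ≠ 0 := by
    have := hM p hp
    rw [h.M_eqOn hp] at this
    rw [Matrix.det_fin_two]
    intro h0
    apply this
    simp only [hT, Matrix.of_apply] at h0
    linarith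
  have hmul : e.curvOp p * T = T * frameCurvMatrix (e.M p) (e.Omega p) (fun k i j => Γ k i j p)
        (fun a k i j => e.covFrameCoeff Γ a k i j p) := by
    ext s j
    have := h.curvOp_mulVec_frame hM hΓ hp j s
    rw [Matrix.mul_apply, Matrix.mul_apply]
    simp only [hT, Matrix.of_apply]
    refine this.trans (Finset.sum_congr rfl fun k _ => mul_comm _ _)
  have := congrArg Matrix.det hmul
  rw [Matrix.det_mul, Matrix.det_mul, mul_comm] at this
  exact mul_left_cancel₀ hdet this

end CubicODE

/-! ### The main theorem -/

theorem theorem7p1 (e : CubicODE) (U : Set (ℝ × ℝ)) (hU : IsOpen U)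
    (hP : ContDiffOn ℝ ∞ e.P U) (hQ : ContDiffOn ℝ ∞ e.Q U)
    (hR : ContDiffOn ℝ ∞ e.R U) (hS : ContDiffOn ℝ ∞ e.S U)
    (hShr : e.ShrID1 U) (hBgd : e.BgdET2 U) :
    (∃ Γ, e.IsFrameCoeff U Γ) ∧
    (∀ Γ Γ', e.IsFrameCoeff U Γ → e.IsFrameCoeff U Γ' →
      ∀ p ∈ U, ∀ k i j, Γ k i j p = Γ' k i j p) ∧
    (∀ p ∈ U, e.bgdj5 p = -125 * (e.curvOp p).det + 45 / 4 * e.Omega p ^ 2) ∧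
    ∀ Γ, e.IsFrameCoeff U Γ → ∀ p ∈ U,
      (∀ j s : Fin 2, (e.curvOp p).mulVec (fun q => e.frame j q p) s =
        ∑ k, frameCurvMatrix (e.M p) (e.Omega p) (fun k i j => Γ k i j p)
          (fun a k i j => e.covFrameCoeff Γ a k i j p) k j * e.frame k s p) ∧
      e.bgdj5 p = j5Expr (e.M p) (e.Omega p) (fun k i j => Γ k i j p)
        (fun a k i j => e.covFrameCoeff Γ a k i j p) := by
  -- `A ≠ 0` comes from `β₁ ≠ 0`, so the identity `β₁ = A` is needed here in the form that does not
  -- presuppose `A ≠ 0`.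
  have h : e.IsRegularOn U := ⟨hU, hP, hQ, hR, hS, fun p hp => by
    rw [← CubicODE.bgdBeta1_eqOn hU hP hQ hR hS hp]
    exact hBgd.beta1_ne_zero p hp⟩
  have hM := hShr.M_ne_zero
  have hj : ∀ p ∈ U, e.bgdj5 p = -125 * (e.curvOp p).det + 45 / 4 * e.Omega p ^ 2 :=
    fun p hp => h.bgdj5_eq hBgd.J0_eq_zero hp
  refine ⟨⟨e.frameCoeff, (h.isFrameCoeff_iff hM).2 fun _ _ _ _ _ => rfl⟩, ?_, hj, ?_⟩
  · intro Γ Γ' hΓ hΓ' p hp k i j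
    rw [(h.isFrameCoeff_iff hM).1 hΓ k i j hp, (h.isFrameCoeff_iff hM).1 hΓ' k i j hp]
  · intro Γ hΓ p hp
    refine ⟨h.curvOp_mulVec_frame hM hΓ hp, ?_⟩
    rw [hj p hp, h.det_curvOp hM hΓ hp, j5Expr]
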